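/- Let $A\in\mathbb R^{n\times n}$, $B\in\mathbb R^{n\times m}$, let $Q,Q_T\in\mathbb R^{n\times n}$ be (symmetric) positive semidefinite and $R\in\mathbb R^{m\times m}$ (symmetric) positive definite, and let $T\in\mathbb Z$ be a fixed final time; times are integers $t\le T$, and the infinite-horizon limit is $t\to-\infty$. Let $w_k\in\mathbb R^n$, $k\ge 1$, be disturbance values with $\sup_k\|w_k\|<\infty$, and for $t<T$, $k\ge 0$ let $p_t^k\in[0,1]$, with $p_t^0=0$, be the probability that a disturbance occurs at time $t$ when $k$ disturbances remain. Define, for $t<T$, $$P_T=Q_T,\qquad P_t=A^\top\big(P_{t+1}-P_{t+1}B(B^\top P_{t+1}B+R)^{-1}B^\top P_{t+1}\big)A+Q,$$ $$K_t=(B^\top P_{t+1}B+R)^{-1}B^\top P_{t+1}A,\qquad F_t=B(R+B^\top P_{t+1}B)^{-1}B^\top,$$ $$r_T^k=0,\qquad r_t^k=A^\top(I-F_tP_{t+1})^\top\big((1-p_t^k)\,r_{t+1}^k+p_t^k\,r_{t+1}^{k-1}+p_t^kP_{t+1}w_k\big)$$ (terms with index $k-1$ or $w_k$ are absent when $k=0$).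 A feedback policy $\pi$ assigns an action $u=\pi(t,k,x)\in\mathbb R^m$ to a time $t<T$, a number $k$ of remaining disturbances and a state $x$; its expected cost-to-go is $J_T^{\pi,k}(x)=x^\top Q_Tx$ and $$J_t^{\pi,k}(x)=x^\top Qx+u^\top Ru+(1-p_t^k)\,J_{t+1}^{\pi,k}(Ax+Bu)+p_t^k\,J_{t+1}^{\pi,k-1}(Ax+Bu+w_k).$$ A *disturbance-aware policy* is a policy that minimizes $J_t^{\pi,k}(x)$ over all policies simultaneously for all $t\le T$, $k\ge 0$, $x\in\mathbb R^n$. Assume: 1. $(A,B)$ is controllable, $Q=L^\top L$ for some $L$ with $(A,L)$ observable, and for some $\gamma>0$ the spectral norm satisfies $\|A-BK_t\|<1-\gamma$ for all $t<T$. 2. For every nondecreasing sequence $k_i\in\mathbb Z_{\ge0}$ and every strictly decreasing sequence of integers $t_i\le T$ with $k_i/t_i\to0$, one has $p_{t_i}^{k_i}\to0$. Let $t_i\le T$ ($i\ge0$) be a strictly decreasing sequence of integers and $k_i\in\mathbb Z_{\ge0}$ a sequence with $k_{i+1}-k_i\in\{0,1\}$ such that $k_i/t_i\to0$, and let $(t_j',k_j')_{j\ge0}$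 be the sequence $$(t_0,k_0),(t_0-1,k_0),\dots,(t_1+1,k_0),(t_1,k_1),(t_1-1,k_1),\dots$$ obtained by including all intermediate time steps. Then $$\big\|r_{t_j'}^{k_j'}\big\|\to0\qquad(j\to\infty),$$ a disturbance-aware policy exists, and every disturbance-aware policy $\pi$ converges to the blind policy: for all states $x_j\in\mathbb R^n$, $$\big\|\pi(t_j',k_j',x_j)-(-K_{t_j'}x_j)\big\|\to0\qquad(j\to\infty).$$ -/

import Mathlib

open Filter Topology
open scoped Matrix

namespace SparseLQR

/-- The data of a linear quadratic regulator with sparse disturbances: the dynamics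
`x_{t+1} = A x_t + B u_t + d_t`, the quadratic costs `Q`, `R` and `QT`, the final time `T`, the
disturbance values `w k` (`w k` is the next disturbance when `k` disturbances remain) and the
probability `p t k` of a disturbance at time `t` when `k` disturbances remain. Times are
integers `t ≤ T`, and `t → -∞` is the infinite-horizon limit. -/
structure Problem (n m : ℕ) where
  A : Matrix (Fin n) (Fin n) ℝ
  B : Matrix (Fin n) (Fin m) ℝ
  Q : Matrix (Fin n) (Fin n) ℝ
  R : Matrix (Fin m) (Fin m) ℝ
  QT : Matrix (Fin n) (Fin n) ℝ
  T : ℤ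
  w : ℕ → Fin n → ℝ
  p : ℤ → ℕ → ℝ

/-- The Euclidean norm of a vector. -/
noncomputable def l2norm {d : ℕ} (v : Fin d → ℝ) : ℝ :=
  ‖(WithLp.toLp 2 v : EuclideanSpace ℝ (Fin d))‖

/-- The spectral norm of a square matrix (the operator norm of the Euclidean norm). -/
noncomputable def spectralNorm {d : ℕ} (M : Matrix (Fin d) (Fin d) ℝ) : ℝ :=
  ‖Matrix.toEuclideanCLM (n := Fin d) (𝕜 := ℝ) M‖

/-- `(A, B)` is controllable: the columns of `B, AB, …, A^{n-1}B` span `ℝⁿ`. -/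
def Controllable {n m : ℕ} (A : Matrix (Fin n) (Fin n) ℝ) (B : Matrix (Fin n) (Fin m) ℝ) : Prop :=
  ⨆ i : Fin n, LinearMap.range (A ^ (i : ℕ) * B).mulVecLin = ⊤

/-- `(A, L)` is observable: the kernels of `L, LA, …, LA^{n-1}` meet only in `0`. -/
def Observable {n l : ℕ} (A : Matrix (Fin n) (Fin n) ℝ) (L : Matrix (Fin l) (Fin n) ℝ) : Prop :=
  ⨅ i : Fin n, LinearMap.ker (L * A ^ (i : ℕ)).mulVecLin = ⊥

namespace Problem

variable {n m : ℕ} (S : Problem n m)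

/-- The Riccati iteration, indexed by the number of time steps to go. -/
noncomputable def riccati : ℕ → Matrix (Fin n) (Fin n) ℝ
  | 0 => S.QT
  | s + 1 =>
      S.Aᵀ * (riccati s - riccati s * S.B * (S.Bᵀ * riccati s * S.B + S.R)⁻¹ * S.Bᵀ * riccati s)
        * S.A + S.Q

/-- The Riccati sequence `P_t`, `t ≤ T`, with `P_T = QT`. -/
noncomputable def P (t : ℤ) : Matrix (Fin n) (Fin n) ℝ := S.riccati (S.T - t).toNat

/-- The feedback matrix `K_t`, `t < T`, of the blind policy `u_t = -K_t x_t`. -/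
noncomputable def K (t : ℤ) : Matrix (Fin m) (Fin n) ℝ :=
  (S.Bᵀ * S.P (t + 1) * S.B + S.R)⁻¹ * S.Bᵀ * S.P (t + 1) * S.A

/-- `F_t = B (R + Bᵀ P_{t+1} B)⁻¹ Bᵀ`, `t < T`. -/
noncomputable def F (t : ℤ) : Matrix (Fin n) (Fin n) ℝ :=
  S.B * (S.R + S.Bᵀ * S.P (t + 1) * S.B)⁻¹ * S.Bᵀ

/-- The linear coefficients of the disturbance-aware cost-to-go, indexed by the number of time
steps to go and the number of disturbances that remain. -/
noncomputable def linCoeff : ℕ → ℕ → Fin n → ℝ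
  | 0, _ => 0
  | s + 1, k =>
      let t : ℤ := S.T - ((s : ℤ) + 1)
      (S.Aᵀ * (1 - S.F t * S.P (t + 1))ᵀ) *ᵥ
        (((1 - S.p t k) • linCoeff s k + S.p t k • linCoeff s (k - 1))
          + S.p t k • (S.P (t + 1) *ᵥ S.w k))

/-- The linear coefficients `r_t^k`, `t ≤ T`, with `r_T^k = 0`. -/
noncomputable def r (t : ℤ) (k : ℕ) : Fin n → ℝ := S.linCoeff (S.T - t).toNat k

/-- A feedback policy: the action at time `t`, with `k` disturbances remaining, in state `x`. -/
abbrev Policy (n m : ℕ) : Type := ℤ → ℕ → (Fin n → ℝ) → (Fin m → ℝ)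

/-- The expected cost that the policy `π` incurs in the last `s` time steps, from state `x` with
`k` disturbances remaining. At time `t` the disturbance `w k` occurs with probability `p t k`, and
then `k - 1` disturbances remain; otherwise there is no disturbance. -/
noncomputable def expectedCost (π : Policy n m) : ℕ → ℕ → (Fin n → ℝ) → ℝ
  | 0, _, x => x ⬝ᵥ (S.QT *ᵥ x)
  | s + 1, k, x =>
      let t : ℤ := S.T - ((s : ℤ) + 1)
      let u := π t k x
      x ⬝ᵥ (S.Q *ᵥ x) + u ⬝ᵥ (S.R *ᵥ u)
        + (1 - S.p t k) * expectedCost π s k (S.A *ᵥ x + S.B *ᵥ u)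
        + S.p t k * expectedCost π s (k - 1) (S.A *ᵥ x + S.B *ᵥ u + S.w k)

/-- `π` is an (optimal) disturbance-aware policy: from every time, number of remaining
disturbances and state, it minimizes the expected cost-to-go among all policies. -/
def IsDisturbanceAware (π : Policy n m) : Prop :=
  ∀ (s k : ℕ) (x : Fin n → ℝ) (π' : Policy n m), S.expectedCost π s k x ≤ S.expectedCost π' s k x

/-- `p t k` are probabilities, and no disturbance can occur once none remains. -/
def IsProbabilityModel : Prop :=
  (∀ t < S.T, ∀ k, 0 ≤ S.p t k ∧ S.p t k ≤ 1) ∧ ∀ t < S.T, S.p t 0 = 0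

/-- The disturbance probability approaches zero if the number of disturbances grows sublinearly. -/
def ProbabilityDecays : Prop :=
  ∀ (t : ℕ → ℤ) (k : ℕ → ℕ), Monotone k → StrictAnti t → (∀ i, t i ≤ S.T) →
    Tendsto (fun i => (k i : ℝ) / (t i : ℝ)) atTop (𝓝 0) →
    Tendsto (fun i => S.p (t i) (k i)) atTop (𝓝 0)

end Problem

/-- `(t' j, k' j)` is the sequence
`(t₀, k₀), (t₀ - 1, k₀), …, (t₁ + 1, k₀), (t₁, k₁), (t₁ - 1, k₁), …`
obtained from `(t i, k i)`, with `t` strictly decreasing, by inserting the intermediate times. -/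
def IsFilledIn (t : ℕ → ℤ) (k : ℕ → ℕ) (t' : ℕ → ℤ) (k' : ℕ → ℕ) : Prop :=
  (∀ j : ℕ, t' j = t 0 - j) ∧ ∀ i j : ℕ, t (i + 1) < t' j → t' j ≤ t i → k' j = k i

end SparseLQR

/-!
Completing the square shows by induction on the number of steps to go that the optimal cost-to-go
is `xᵀ P x + 2 xᵀ r + const` (`Problem.value_succ`), and that the optimal action is unique and
differs from the blind one `-K x` by `(Bᵀ P B + R)⁻¹ Bᵀ g`, where
`g = (1 - p) r_{t+1}^k + p r_{t+1}^{k-1} + p P w` (`Problem.forcing`). Both claims therefore reduce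
to the decay of `r` and `p`.

The recursion for `r` is `r_t^k = (A - B K_t)ᵀ g`, and `A - B K_t` is a contraction with a uniform
factor `ρ < 1`. Comparison with the constant gain `K (T - 1)`, whose closed loop is such a
contraction, bounds the matrices `P_t`, whence `r` is bounded, and
`|r_t^k| ≤ ρ (|r_{t+1}^k| + D p_t^k)` for a constant `D`. In this inequality the number `k` of
disturbances is the same on both sides. So it can be iterated a fixed number `N` of times with `k`
fixed: the remainder is at most `ρ ^ N` times the bound of `r`, and the other terms involve only
the probabilities `p_{t+i}^k` with `i < N`. Along the filled-in sequence these vanish for each fixed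
`i`, because `(t'_j + i, k'_j)` is again a sequence along which the number of disturbances grows
sublinearly (`IsFilledIn.tendsto_p`). Letting `N` grow gives `r → 0`
(`tendsto_zero_of_le_mul_succ`).
-/

namespace SparseLQR

/-! ### The Euclidean norm of vectors and matrix bounds -/

lemma l2norm_nonneg {d : ℕ} (v : Fin d → ℝ) : 0 ≤ l2norm v := norm_nonneg _

lemma l2norm_add_le {d : ℕ} (v w : Fin d → ℝ) : l2norm (v + w) ≤ l2norm v + l2norm w :=
  norm_add_le (WithLp.toLp 2 v : EuclideanSpace ℝ (Fin d)) (WithLp.toLp 2 w)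

lemma l2norm_smul {d : ℕ} (a : ℝ) (v : Fin d → ℝ) : l2norm (a • v) = |a| * l2norm v :=
  norm_smul a (WithLp.toLp 2 v : EuclideanSpace ℝ (Fin d))

lemma l2norm_neg {d : ℕ} (v : Fin d → ℝ) : l2norm (-v) = l2norm v :=
  norm_neg (WithLp.toLp 2 v : EuclideanSpace ℝ (Fin d))

lemma l2norm_zero {d : ℕ} : l2norm (0 : Fin d → ℝ) = 0 :=
  norm_zero (E := EuclideanSpace ℝ (Fin d))

lemma inner_toLp {d : ℕ} (v w : Fin d → ℝ) :
    inner ℝ (WithLp.toLp 2 v : EuclideanSpace ℝ (Fin d)) (WithLp.toLp 2 w) = v ⬝ᵥ w := by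
  rw [EuclideanSpace.inner_toLp_toLp, dotProduct_comm]; simp

lemma l2norm_sq {d : ℕ} (v : Fin d → ℝ) : l2norm v ^ 2 = v ⬝ᵥ v := by
  rw [l2norm, ← real_inner_self_eq_norm_sq, inner_toLp]

lemma dotProduct_le_l2norm_mul {d : ℕ} (v w : Fin d → ℝ) : v ⬝ᵥ w ≤ l2norm v * l2norm w := by
  rw [← inner_toLp]; exact real_inner_le_norm _ _

lemma l2norm_mulVec_le {d : ℕ} (M : Matrix (Fin d) (Fin d) ℝ) (v : Fin d → ℝ) :
    l2norm (M *ᵥ v) ≤ spectralNorm M * l2norm v :=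
  (Matrix.toEuclideanCLM (n := Fin d) (𝕜 := ℝ) M).le_opNorm (WithLp.toLp 2 v)

lemma exists_l2norm_mulVec_le {d e : ℕ} (M : Matrix (Fin e) (Fin d) ℝ) :
    ∃ c : ℝ, 0 ≤ c ∧ ∀ v, l2norm (M *ᵥ v) ≤ c * l2norm v := by
  let f : EuclideanSpace ℝ (Fin d) →L[ℝ] EuclideanSpace ℝ (Fin e) :=
    LinearMap.toContinuousLinearMap (Matrix.toLpLin 2 2 M)
  exact ⟨‖f‖, norm_nonneg _, fun v => f.le_opNorm (WithLp.toLp 2 v)⟩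

lemma dotProduct_mulVec_transpose {d e : ℕ} (M : Matrix (Fin e) (Fin d) ℝ)
    (x : Fin d → ℝ) (y : Fin e → ℝ) : x ⬝ᵥ (Mᵀ *ᵥ y) = (M *ᵥ x) ⬝ᵥ y := by
  rw [Matrix.dotProduct_mulVec, Matrix.vecMul_transpose]

/-- Transposition does not increase the operator norm. -/
lemma l2norm_transpose_mulVec_le {d e : ℕ} {M : Matrix (Fin e) (Fin d) ℝ} {c : ℝ} (hc : 0 ≤ c)
    (hM : ∀ v, l2norm (M *ᵥ v) ≤ c * l2norm v) (v : Fin e → ℝ) :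
    l2norm (Mᵀ *ᵥ v) ≤ c * l2norm v := by
  have h : l2norm (Mᵀ *ᵥ v) ^ 2 ≤ c * l2norm (Mᵀ *ᵥ v) * l2norm v := by
    rw [l2norm_sq, dotProduct_mulVec_transpose]
    exact (dotProduct_le_l2norm_mul _ _).trans
      (mul_le_mul_of_nonneg_right (hM _) (l2norm_nonneg _))
  rcases (l2norm_nonneg (Mᵀ *ᵥ v)).eq_or_lt with h0 | h0
  · rw [← h0]
    exact mul_nonneg hc (l2norm_nonneg v)
  · nlinarith

lemma _root_.Matrix.PosSemidef.transpose_eq {d : ℕ} {M : Matrix (Fin d) (Fin d) ℝ}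
    (hM : M.PosSemidef) : Mᵀ = M := by
  simpa using hM.isHermitian.eq

lemma dotProduct_mulVec_comm_of_transpose_eq {d : ℕ} {M : Matrix (Fin d) (Fin d) ℝ}
    (hM : Mᵀ = M) (x y : Fin d → ℝ) : x ⬝ᵥ (M *ᵥ y) = (M *ᵥ x) ⬝ᵥ y := by
  conv_lhs => rw [← hM]
  rw [dotProduct_mulVec_transpose]

/-- If `0 ≤ M ≤ c` as quadratic forms, then `M² ≤ c M`. This is nonnegativity of the form at
`x - c⁻¹ M x`. -/
lemma l2norm_mulVec_sq_le_of_quadForm_le {d : ℕ} {M : Matrix (Fin d) (Fin d) ℝ}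
    (hM : M.PosSemidef) {c : ℝ} (hc : 0 < c) (h : ∀ x, x ⬝ᵥ (M *ᵥ x) ≤ c * l2norm x ^ 2)
    (x : Fin d → ℝ) : l2norm (M *ᵥ x) ^ 2 ≤ c * (x ⬝ᵥ (M *ᵥ x)) := by
  have h1 := h (M *ᵥ x)
  have h2 : 0 ≤ (x - c⁻¹ • (M *ᵥ x)) ⬝ᵥ (M *ᵥ (x - c⁻¹ • (M *ᵥ x))) := by
    simpa using hM.dotProduct_mulVec_nonneg (x - c⁻¹ • (M *ᵥ x))
  have h3 : x ⬝ᵥ (M *ᵥ (M *ᵥ x)) = l2norm (M *ᵥ x) ^ 2 := by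
    rw [dotProduct_mulVec_comm_of_transpose_eq hM.transpose_eq, l2norm_sq]
  simp only [Matrix.mulVec_sub, Matrix.mulVec_smul, sub_dotProduct, dotProduct_sub,
    smul_dotProduct, dotProduct_smul, smul_eq_mul, h3, ← l2norm_sq] at h2
  have h4 : c⁻¹ * (c⁻¹ * ((M *ᵥ x) ⬝ᵥ (M *ᵥ (M *ᵥ x)))) ≤ c⁻¹ * l2norm (M *ᵥ x) ^ 2 := by
    rw [← mul_assoc, ← sq]
    refine (mul_le_mul_of_nonneg_left h1 (sq_nonneg _)).trans_eq ?_
    field_simp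
  have h5 : c⁻¹ * l2norm (M *ᵥ x) ^ 2 ≤ x ⬝ᵥ (M *ᵥ x) := by
    rw [mul_sub] at h2
    linarith
  exact (inv_mul_le_iff₀ hc).1 h5

lemma quadForm_le {d : ℕ} {M : Matrix (Fin d) (Fin d) ℝ} {c : ℝ}
    (hM : ∀ v, l2norm (M *ᵥ v) ≤ c * l2norm v) (x : Fin d → ℝ) :
    x ⬝ᵥ (M *ᵥ x) ≤ c * l2norm x ^ 2 := by
  nlinarith [dotProduct_le_l2norm_mul x (M *ᵥ x), hM x, l2norm_nonneg x]

lemma l2norm_mulVec_le_of_quadForm_le {d : ℕ} {M : Matrix (Fin d) (Fin d) ℝ}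
    (hM : M.PosSemidef) {c : ℝ} (hc : 0 < c) (h : ∀ x, x ⬝ᵥ (M *ᵥ x) ≤ c * l2norm x ^ 2)
    (x : Fin d → ℝ) : l2norm (M *ᵥ x) ≤ c * l2norm x := by
  have h1 := l2norm_mulVec_sq_le_of_quadForm_le hM hc h x
  have h2 := mul_le_mul_of_nonneg_left (h x) hc.le
  exact le_of_sq_le_sq (by nlinarith) (mul_nonneg hc.le (l2norm_nonneg x))

lemma exists_pos_mul_l2norm_sq_le {d : ℕ} {R : Matrix (Fin d) (Fin d) ℝ} (hR : R.PosDef) :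
    ∃ a : ℝ, 0 < a ∧ ∀ u, a * l2norm u ^ 2 ≤ u ⬝ᵥ (R *ᵥ u) := by
  obtain ⟨c, hc, hRc⟩ := exists_l2norm_mulVec_le R
  obtain ⟨e, he, hRe⟩ := exists_l2norm_mulVec_le R⁻¹
  have hc' : 0 < c + 1 := by linarith
  have hdet : IsUnit R.det := (Matrix.isUnit_iff_isUnit_det _).1 hR.isUnit
  refine ⟨((c + 1) * (e + 1) ^ 2)⁻¹, by positivity, fun u => ?_⟩
  rw [inv_mul_le_iff₀ (by positivity)]
  have h1 := l2norm_mulVec_sq_le_of_quadForm_le hR.posSemidef hc'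
    (quadForm_le fun v => (hRc v).trans (by nlinarith [l2norm_nonneg v])) u
  have h2 : l2norm u ≤ (e + 1) * l2norm (R *ᵥ u) := by
    have h := hRe (R *ᵥ u)
    rw [Matrix.mulVec_mulVec, Matrix.nonsing_inv_mul _ hdet, Matrix.one_mulVec] at h
    nlinarith [l2norm_nonneg (R *ᵥ u)]
  calc l2norm u ^ 2 ≤ ((e + 1) * l2norm (R *ᵥ u)) ^ 2 := by gcongr; exact l2norm_nonneg u
    _ = (e + 1) ^ 2 * l2norm (R *ᵥ u) ^ 2 := by ring
    _ ≤ (e + 1) ^ 2 * ((c + 1) * (u ⬝ᵥ (R *ᵥ u))) := by gcongr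
    _ = _ := by ring

/-! ### Completing the square -/

/-- The quadratic cost of one step, `g` being the linear part of the cost-to-go, as a function of
the action `u`: its minimizer is `-G⁻¹ Bᵀ (P A x + g)`, where `G = Bᵀ P B + R`. -/
lemma completing_square {n m : ℕ} {A P Q : Matrix (Fin n) (Fin n) ℝ}
    {B : Matrix (Fin n) (Fin m) ℝ} {R : Matrix (Fin m) (Fin m) ℝ}
    (hP : P.PosSemidef) (hR : R.PosDef) (x g : Fin n → ℝ) (u : Fin m → ℝ) :
    x ⬝ᵥ (Q *ᵥ x) + u ⬝ᵥ (R *ᵥ u) + (A *ᵥ x + B *ᵥ u) ⬝ᵥ (P *ᵥ (A *ᵥ x + B *ᵥ u))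
        + 2 * ((A *ᵥ x + B *ᵥ u) ⬝ᵥ g) =
      x ⬝ᵥ ((Aᵀ * (P - P * B * (Bᵀ * P * B + R)⁻¹ * Bᵀ * P) * A + Q) *ᵥ x)
        + 2 * (x ⬝ᵥ ((Aᵀ * (1 - B * (R + Bᵀ * P * B)⁻¹ * Bᵀ * P)ᵀ) *ᵥ g))
        - g ⬝ᵥ ((B * (R + Bᵀ * P * B)⁻¹ * Bᵀ) *ᵥ g)
        + (u + (Bᵀ * P * B + R)⁻¹ *ᵥ (Bᵀ *ᵥ (P *ᵥ (A *ᵥ x) + g))) ⬝ᵥ ((Bᵀ * P * B + R) *ᵥ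
          (u + (Bᵀ * P * B + R)⁻¹ *ᵥ (Bᵀ *ᵥ (P *ᵥ (A *ᵥ x) + g)))) := by
  have hPt : Pᵀ = P := by simpa using hP.isHermitian.eq
  have hG : (Bᵀ * P * B + R).PosDef := by
    have := hP.conjTranspose_mul_mul_same B
    rw [Matrix.conjTranspose_eq_transpose_of_trivial] at this
    exact Matrix.PosDef.posSemidef_add this hR
  have hGs : (Bᵀ * P * B + R)ᵀ = Bᵀ * P * B + R := by simpa using hG.isHermitian.eq
  have hGR : ∀ v, R *ᵥ v = (Bᵀ * P * B + R) *ᵥ v - Bᵀ *ᵥ (P *ᵥ (B *ᵥ v)) := fun v => by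
    simp [Matrix.add_mulVec, Matrix.mulVec_mulVec, Matrix.mul_assoc]
  have hdet : IsUnit (Bᵀ * P * B + R).det := (Matrix.isUnit_iff_isUnit_det _).1 hG.isUnit
  have hGi : ∀ v, (Bᵀ * P * B + R) *ᵥ ((Bᵀ * P * B + R)⁻¹ *ᵥ v) = v := fun v => by
    rw [Matrix.mulVec_mulVec, Matrix.mul_nonsing_inv _ hdet, Matrix.one_mulVec]
  rw [add_comm R]
  have hGis : ((Bᵀ * P * B + R)⁻¹)ᵀ = (Bᵀ * P * B + R)⁻¹ := by
    rw [Matrix.transpose_nonsing_inv, hGs]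
  rw [hGR]
  generalize Bᵀ * P * B + R = G at *
  have hPx := dotProduct_mulVec_comm_of_transpose_eq hPt
  have hGx := dotProduct_mulVec_comm_of_transpose_eq hGs
  have hN : ∀ v w, v ⬝ᵥ (B *ᵥ (G⁻¹ *ᵥ (Bᵀ *ᵥ w))) = w ⬝ᵥ (B *ᵥ (G⁻¹ *ᵥ (Bᵀ *ᵥ v))) := by
    intro v w
    have hB : ∀ v z, v ⬝ᵥ (B *ᵥ z) = (Bᵀ *ᵥ v) ⬝ᵥ z := fun v z => by
      rw [dotProduct_comm, ← dotProduct_mulVec_transpose, dotProduct_comm]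
    rw [hB, hB, dotProduct_mulVec_comm_of_transpose_eq hGis, dotProduct_comm]
  have hcross : ∀ v, (G⁻¹ *ᵥ (Bᵀ *ᵥ v)) ⬝ᵥ (G *ᵥ u) = (B *ᵥ u) ⬝ᵥ v := fun v => by
    rw [hGx, hGi, dotProduct_comm, dotProduct_mulVec_transpose]
  simp only [Matrix.transpose_sub, Matrix.transpose_mul, Matrix.transpose_one, hPt, hGis,
    Matrix.transpose_transpose, Matrix.add_mulVec, Matrix.sub_mulVec, Matrix.mul_sub,
    Matrix.sub_mul, Matrix.mul_one,
    ← Matrix.mulVec_mulVec, Matrix.mulVec_add, dotProduct_mulVec_transpose,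
    dotProduct_add, dotProduct_sub, add_dotProduct, hGi, hcross]
  have e1 := hPx (A *ᵥ x) (B *ᵥ u)
  rw [dotProduct_comm (P *ᵥ _)] at e1
  have e2 := hPx (A *ᵥ x) (B *ᵥ (G⁻¹ *ᵥ (Bᵀ *ᵥ g)))
  have e3 := hPx (A *ᵥ x) (B *ᵥ (G⁻¹ *ᵥ (Bᵀ *ᵥ (P *ᵥ (A *ᵥ x)))))
  have e4 := hN (P *ᵥ (A *ᵥ x)) g
  rw [e1, e2, e3, dotProduct_comm (B *ᵥ (G⁻¹ *ᵥ (Bᵀ *ᵥ g))) g,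
    dotProduct_comm (B *ᵥ (G⁻¹ *ᵥ (Bᵀ *ᵥ g))),
    dotProduct_comm (B *ᵥ (G⁻¹ *ᵥ (Bᵀ *ᵥ (P *ᵥ (A *ᵥ x))))) g, ← e4,
    dotProduct_comm (B *ᵥ (G⁻¹ *ᵥ (Bᵀ *ᵥ (P *ᵥ (A *ᵥ x))))) (P *ᵥ _)]
  ring

namespace Problem

variable {n m : ℕ} (S : Problem n m)

/-! ### The value function and the optimal policy -/

lemma posDef_quadratic {P : Matrix (Fin n) (Fin n) ℝ} (hP : P.PosSemidef) (hR : S.R.PosDef) :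
    (S.Bᵀ * P * S.B + S.R).PosDef := by
  have := hP.conjTranspose_mul_mul_same S.B
  rw [Matrix.conjTranspose_eq_transpose_of_trivial] at this
  exact Matrix.PosDef.posSemidef_add this hR

/-- The linear part of the expected cost-to-go after the step from time `T - (s + 1)`, as a
function of the state reached without a disturbance. -/
noncomputable def forcing (s k : ℕ) : Fin n → ℝ :=
  ((1 - S.p (S.T - ((s : ℤ) + 1)) k) • S.linCoeff s k
      + S.p (S.T - ((s : ℤ) + 1)) k • S.linCoeff s (k - 1))
    + S.p (S.T - ((s : ℤ) + 1)) k • (S.riccati s *ᵥ S.w k)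

/-- The constant part of the optimal cost-to-go. -/
noncomputable def constCoeff : ℕ → ℕ → ℝ
  | 0, _ => 0
  | s + 1, k =>
      (1 - S.p (S.T - ((s : ℤ) + 1)) k) * constCoeff s k
        + S.p (S.T - ((s : ℤ) + 1)) k * (constCoeff s (k - 1) + S.w k ⬝ᵥ (S.riccati s *ᵥ S.w k)
            + 2 * (S.w k ⬝ᵥ S.linCoeff s (k - 1)))
        - S.forcing s k ⬝ᵥ (S.F (S.T - ((s : ℤ) + 1)) *ᵥ S.forcing s k)

/-- The optimal expected cost-to-go with `s` steps to go: a quadratic polynomial in the state. -/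
noncomputable def value (s k : ℕ) (x : Fin n → ℝ) : ℝ :=
  x ⬝ᵥ (S.riccati s *ᵥ x) + 2 * (x ⬝ᵥ S.linCoeff s k) + S.constCoeff s k

/-- The optimal action with `s + 1` steps to go. -/
noncomputable def optAction (s k : ℕ) (x : Fin n → ℝ) : Fin m → ℝ :=
  -((S.Bᵀ * S.riccati s * S.B + S.R)⁻¹ *ᵥ
    (S.Bᵀ *ᵥ (S.riccati s *ᵥ (S.A *ᵥ x) + S.forcing s k)))

/-- The policy that takes the optimal action at each time before `T`. -/
noncomputable def optPolicy : Policy n m := fun t => S.optAction (S.T - 1 - t).toNat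

lemma optPolicy_eq (s k : ℕ) (x : Fin n → ℝ) :
    S.optPolicy (S.T - ((s : ℤ) + 1)) k x = S.optAction s k x := by
  have : (S.T - 1 - (S.T - ((s : ℤ) + 1))).toNat = s := by omega
  rw [optPolicy, this]

lemma P_eq (s : ℕ) : S.P (S.T - ((s : ℤ) + 1) + 1) = S.riccati s := by
  have : (S.T - (S.T - ((s : ℤ) + 1) + 1)).toNat = s := by omega
  rw [P, this]

lemma linCoeff_succ (s k : ℕ) : S.linCoeff (s + 1) k =
    (S.Aᵀ * (1 - S.B * (S.R + S.Bᵀ * S.riccati s * S.B)⁻¹ * S.Bᵀ * S.riccati s)ᵀ)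
      *ᵥ S.forcing s k := by
  rw [linCoeff, F, P_eq, forcing]

lemma riccati_posSemidef (hQ : S.Q.PosSemidef) (hQT : S.QT.PosSemidef) (hR : S.R.PosDef)
    (s : ℕ) : (S.riccati s).PosSemidef := by
  induction s with
  | zero => exact hQT
  | succ s ih =>
    have hG : ((S.Bᵀ * S.riccati s * S.B + S.R)⁻¹)ᵀ = (S.Bᵀ * S.riccati s * S.B + S.R)⁻¹ := by
      rw [Matrix.transpose_nonsing_inv, (S.posDef_quadratic ih hR).posSemidef.transpose_eq]
    refine Matrix.PosSemidef.of_dotProduct_mulVec_nonneg ?_ fun x => ?_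
    · rw [Matrix.IsHermitian, Matrix.conjTranspose_eq_transpose_of_trivial, riccati]
      generalize (S.Bᵀ * S.riccati s * S.B + S.R)⁻¹ = H at hG
      simp only [Matrix.transpose_add, Matrix.transpose_mul, Matrix.transpose_sub, hG,
        ih.transpose_eq, hQ.transpose_eq, Matrix.transpose_transpose, Matrix.mul_assoc]
    · -- the form equals the cost of a step with the minimizing action
      have h := completing_square (A := S.A) (Q := S.Q) (B := S.B) ih hR x 0
        (-((S.Bᵀ * S.riccati s * S.B + S.R)⁻¹ *ᵥ (S.Bᵀ *ᵥ (S.riccati s *ᵥ (S.A *ᵥ x) + 0))))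
      rw [neg_add_cancel] at h
      simp only [dotProduct_zero, Matrix.mulVec_zero, mul_zero, add_zero, sub_zero] at h
      rw [star_trivial, riccati, ← h]
      have h1 := hQ.dotProduct_mulVec_nonneg x
      have h2 := hR.posSemidef.dotProduct_mulVec_nonneg
        (-((S.Bᵀ * S.riccati s * S.B + S.R)⁻¹ *ᵥ (S.Bᵀ *ᵥ (S.riccati s *ᵥ (S.A *ᵥ x)))))
      have h3 := ih.dotProduct_mulVec_nonneg (S.A *ᵥ x + S.B *ᵥ
        (-((S.Bᵀ * S.riccati s * S.B + S.R)⁻¹ *ᵥ (S.Bᵀ *ᵥ (S.riccati s *ᵥ (S.A *ᵥ x))))))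
      simp only [star_trivial] at h1 h2 h3
      positivity

/-- The Bellman equation, with the excess cost of an action `u` that is not optimal. -/
lemma value_succ (hQ : S.Q.PosSemidef) (hQT : S.QT.PosSemidef) (hR : S.R.PosDef)
    (s k : ℕ) (x : Fin n → ℝ) (u : Fin m → ℝ) :
    x ⬝ᵥ (S.Q *ᵥ x) + u ⬝ᵥ (S.R *ᵥ u)
        + (1 - S.p (S.T - ((s : ℤ) + 1)) k) * S.value s k (S.A *ᵥ x + S.B *ᵥ u)
        + S.p (S.T - ((s : ℤ) + 1)) k * S.value s (k - 1) (S.A *ᵥ x + S.B *ᵥ u + S.w k) =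
      S.value (s + 1) k x + (u - S.optAction s k x) ⬝ᵥ
        ((S.Bᵀ * S.riccati s * S.B + S.R) *ᵥ (u - S.optAction s k x)) := by
  have hP := S.riccati_posSemidef hQ hQT hR s
  have h := completing_square (A := S.A) (Q := S.Q) (B := S.B) hP hR x (S.forcing s k) u
  rw [← linCoeff_succ] at h
  rw [optAction, sub_neg_eq_add]
  have hF : S.F (S.T - ((s : ℤ) + 1))
      = S.B * (S.R + S.Bᵀ * S.riccati s * S.B)⁻¹ * S.Bᵀ := by rw [F, P_eq]
  generalize hD : (u + _) ⬝ᵥ ((S.Bᵀ * S.riccati s * S.B + S.R) *ᵥ _) = D at h ⊢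
  rw [← riccati, ← hF] at h
  simp only [value, constCoeff]
  generalize S.A *ᵥ x + S.B *ᵥ u = y at *
  have hy : y ⬝ᵥ S.forcing s k = (1 - S.p (S.T - ((s : ℤ) + 1)) k) * (y ⬝ᵥ S.linCoeff s k)
      + S.p (S.T - ((s : ℤ) + 1)) k * (y ⬝ᵥ S.linCoeff s (k - 1))
      + S.p (S.T - ((s : ℤ) + 1)) k * (y ⬝ᵥ (S.riccati s *ᵥ S.w k)) := by
    simp only [forcing, dotProduct_add, dotProduct_smul, smul_eq_mul]
  have hw : S.w k ⬝ᵥ (S.riccati s *ᵥ y) = y ⬝ᵥ (S.riccati s *ᵥ S.w k) := by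
    rw [dotProduct_mulVec_comm_of_transpose_eq hP.transpose_eq, dotProduct_comm]
  rw [hy] at h
  simp only [Matrix.mulVec_add, add_dotProduct, dotProduct_add, hw]
  linear_combination h

lemma value_zero (k : ℕ) (x : Fin n → ℝ) : S.value 0 k x = x ⬝ᵥ (S.QT *ᵥ x) := by
  simp [value, riccati, linCoeff, constCoeff]

lemma expectedCost_optPolicy (hQ : S.Q.PosSemidef) (hQT : S.QT.PosSemidef) (hR : S.R.PosDef)
    (s k : ℕ) (x : Fin n → ℝ) : S.expectedCost S.optPolicy s k x = S.value s k x := by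
  induction s generalizing k x with
  | zero => rw [value_zero, expectedCost]
  | succ s ih =>
    rw [expectedCost]
    simp only [ih, optPolicy_eq]
    rw [S.value_succ hQ hQT hR]
    simp

lemma value_le_expectedCost (hQ : S.Q.PosSemidef) (hQT : S.QT.PosSemidef) (hR : S.R.PosDef)
    (hp : S.IsProbabilityModel) (π : Policy n m) (s k : ℕ) (x : Fin n → ℝ) :
    S.value s k x ≤ S.expectedCost π s k x := by
  induction s generalizing k x with
  | zero => rw [value_zero, expectedCost]
  | succ s ih =>
    rw [expectedCost]
    obtain ⟨h0, h1⟩ := hp.1 (S.T - ((s : ℤ) + 1)) (by omega) k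
    have hG := (S.posDef_quadratic (S.riccati_posSemidef hQ hQT hR s)
      hR).posSemidef.dotProduct_mulVec_nonneg
        (π (S.T - ((s : ℤ) + 1)) k x - S.optAction s k x)
    rw [star_trivial] at hG
    have h := S.value_succ hQ hQT hR s k x (π (S.T - ((s : ℤ) + 1)) k x)
    have e1 := mul_le_mul_of_nonneg_left
      (ih k (S.A *ᵥ x + S.B *ᵥ π (S.T - ((s : ℤ) + 1)) k x)) (sub_nonneg.2 h1)
    have e2 := mul_le_mul_of_nonneg_left
      (ih (k - 1) (S.A *ᵥ x + S.B *ᵥ π (S.T - ((s : ℤ) + 1)) k x + S.w k)) h0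
    show _ ≤ _ + _ + _ + _
    linarith

lemma isDisturbanceAware_optPolicy (hQ : S.Q.PosSemidef) (hQT : S.QT.PosSemidef)
    (hR : S.R.PosDef) (hp : S.IsProbabilityModel) : S.IsDisturbanceAware S.optPolicy :=
  fun s k x π' => by
    rw [S.expectedCost_optPolicy hQ hQT hR]
    exact S.value_le_expectedCost hQ hQT hR hp π' s k x

/-- Disturbance-aware policies are unique before the final time, because the excess cost of an
action is a positive definite form in its distance from the optimal one. -/
lemma IsDisturbanceAware.eq_optAction {S : Problem n m} (hQ : S.Q.PosSemidef)
    (hQT : S.QT.PosSemidef) (hR : S.R.PosDef) (hp : S.IsProbabilityModel) {π : Policy n m}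
    (hπ : S.IsDisturbanceAware π) (s k : ℕ) (x : Fin n → ℝ) :
    π (S.T - ((s : ℤ) + 1)) k x = S.optAction s k x := by
  have hval : ∀ s k x, S.expectedCost π s k x = S.value s k x := fun s k x =>
    le_antisymm ((hπ s k x S.optPolicy).trans_eq (S.expectedCost_optPolicy hQ hQT hR s k x))
      (S.value_le_expectedCost hQ hQT hR hp π s k x)
  have h := hval (s + 1) k x
  rw [expectedCost] at h
  simp only [hval] at h
  rw [S.value_succ hQ hQT hR, add_eq_left] at h
  by_contra hne
  have := (S.posDef_quadratic (S.riccati_posSemidef hQ hQT hR s) hR).dotProduct_mulVec_pos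
    (sub_ne_zero.2 hne)
  rw [star_trivial, h] at this
  exact lt_irrefl _ this

/-! ### Bounds that are uniform in time -/

lemma closedLoop_eq (s : ℕ) :
    S.A - S.B * S.K (S.T - ((s : ℤ) + 1)) =
      (1 - S.B * (S.R + S.Bᵀ * S.riccati s * S.B)⁻¹ * S.Bᵀ * S.riccati s) * S.A := by
  rw [K, P_eq, add_comm S.R]
  simp only [Matrix.sub_mul, Matrix.one_mul, Matrix.mul_assoc]

/-- The Riccati matrices are bounded: the cost of the constant gain `K (T - 1)`, whose closed loop
is a contraction, is an upper bound for the optimal cost. -/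
lemma exists_riccati_bound (hQ : S.Q.PosSemidef) (hQT : S.QT.PosSemidef) (hR : S.R.PosDef)
    {ρ : ℝ} (hρ0 : 0 ≤ ρ) (hρ1 : ρ < 1)
    (hρ : ∀ t < S.T, spectralNorm (S.A - S.B * S.K t) ≤ ρ) :
    ∃ c : ℝ, 0 < c ∧ ∀ s v, l2norm (S.riccati s *ᵥ v) ≤ c * l2norm v := by
  obtain ⟨q, hq0, hq⟩ := exists_l2norm_mulVec_le S.Q
  obtain ⟨qT, hqT0, hqT⟩ := exists_l2norm_mulVec_le S.QT
  obtain ⟨e, he0, he⟩ := exists_l2norm_mulVec_le S.R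
  obtain ⟨κ, hκ0, hκ⟩ := exists_l2norm_mulVec_le (S.K (S.T - 1))
  have hgap : 0 < 1 - ρ ^ 2 := by nlinarith
  set C : ℝ := q + e * κ ^ 2 with hC
  have hC0 : 0 ≤ C := by positivity
  -- `c` solves `C + ρ² c ≤ c`, so that the bound propagates along the Riccati recursion
  set c : ℝ := qT + 1 + C / (1 - ρ ^ 2) with hc
  have hc0 : 0 < c := by positivity
  have hcC : C + ρ ^ 2 * c ≤ c := by
    have h1 : C / (1 - ρ ^ 2) ≤ c := by rw [hc]; linarith
    rw [div_le_iff₀ hgap] at h1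
    linarith
  refine ⟨c, hc0, fun s => l2norm_mulVec_le_of_quadForm_le
    (S.riccati_posSemidef hQ hQT hR s) hc0 ?_⟩
  induction s with
  | zero =>
    intro x
    refine (quadForm_le hqT x).trans ?_
    gcongr
    rw [hc]
    linarith [div_nonneg hC0 hgap.le]
  | succ s ih =>
    intro x
    have hP := S.riccati_posSemidef hQ hQT hR s
    have h := completing_square (A := S.A) (Q := S.Q) (B := S.B) hP hR x 0
      (-(S.K (S.T - 1) *ᵥ x))
    have hG := (S.posDef_quadratic hP hR).posSemidef.dotProduct_mulVec_nonneg
      (-(S.K (S.T - 1) *ᵥ x) + (S.Bᵀ * S.riccati s * S.B + S.R)⁻¹ *ᵥ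
        (S.Bᵀ *ᵥ (S.riccati s *ᵥ (S.A *ᵥ x) + 0)))
    rw [star_trivial] at hG
    rw [← riccati] at h
    have hy : S.A *ᵥ x + S.B *ᵥ (-(S.K (S.T - 1) *ᵥ x))
        = (S.A - S.B * S.K (S.T - 1)) *ᵥ x := by
      rw [Matrix.sub_mulVec, Matrix.mulVec_neg, Matrix.mulVec_mulVec, ← sub_eq_add_neg]
    rw [hy] at h
    simp only [dotProduct_zero, Matrix.mulVec_zero, mul_zero, add_zero, sub_zero] at h hG
    have h1 := quadForm_le hq x
    have h2 := quadForm_le he (-(S.K (S.T - 1) *ᵥ x))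
    rw [l2norm_neg] at h2
    have h3 : l2norm (S.K (S.T - 1) *ᵥ x) ^ 2 ≤ κ ^ 2 * l2norm x ^ 2 := by
      rw [← mul_pow]
      exact pow_le_pow_left₀ (l2norm_nonneg _) (hκ x) 2
    have h4 := ih ((S.A - S.B * S.K (S.T - 1)) *ᵥ x)
    have h5 : l2norm ((S.A - S.B * S.K (S.T - 1)) *ᵥ x) ^ 2 ≤ ρ ^ 2 * l2norm x ^ 2 := by
      rw [← mul_pow]
      exact pow_le_pow_left₀ (l2norm_nonneg _) ((l2norm_mulVec_le _ x).trans
        (mul_le_mul_of_nonneg_right (hρ _ (by omega)) (l2norm_nonneg x))) 2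
    have h6 := mul_le_mul_of_nonneg_left h3 he0
    have h7 := mul_le_mul_of_nonneg_left h5 hc0.le
    have h8 := mul_le_mul_of_nonneg_right hcC (sq_nonneg (l2norm x))
    rw [hC] at h8
    linarith

lemma l2norm_forcing_le (hp : S.IsProbabilityModel) {c W : ℝ} (hc : 0 ≤ c)
    (hP : ∀ s v, l2norm (S.riccati s *ᵥ v) ≤ c * l2norm v)
    (hW : ∀ k, 1 ≤ k → l2norm (S.w k) ≤ W) (s k : ℕ) :
    l2norm (S.forcing s k) ≤
      (1 - S.p (S.T - ((s : ℤ) + 1)) k) * l2norm (S.linCoeff s k)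
        + S.p (S.T - ((s : ℤ) + 1)) k * l2norm (S.linCoeff s (k - 1))
        + S.p (S.T - ((s : ℤ) + 1)) k * (c * W) := by
  obtain ⟨h0, h1⟩ := hp.1 (S.T - ((s : ℤ) + 1)) (by omega) k
  refine (l2norm_add_le _ _).trans (add_le_add ((l2norm_add_le _ _).trans ?_) ?_)
  · rw [l2norm_smul, l2norm_smul, abs_of_nonneg h0, abs_of_nonneg (sub_nonneg.2 h1)]
  · rw [l2norm_smul, abs_of_nonneg h0]
    rcases Nat.eq_zero_or_pos k with rfl | hk
    · rw [hp.2 _ (by omega), zero_mul, zero_mul]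
    · exact mul_le_mul_of_nonneg_left
        ((hP _ _).trans (mul_le_mul_of_nonneg_left (hW k hk) hc)) h0

lemma l2norm_linCoeff_succ_le {ρ : ℝ} (hρ0 : 0 ≤ ρ)
    (hρ : ∀ t < S.T, spectralNorm (S.A - S.B * S.K t) ≤ ρ) (s k : ℕ) :
    l2norm (S.linCoeff (s + 1) k) ≤ ρ * l2norm (S.forcing s k) := by
  rw [linCoeff_succ, ← Matrix.transpose_mul, ← closedLoop_eq]
  exact l2norm_transpose_mulVec_le hρ0 (fun v => (l2norm_mulVec_le _ v).trans
    (mul_le_mul_of_nonneg_right (hρ _ (by omega)) (l2norm_nonneg v))) _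

lemma l2norm_linCoeff_le (hp : S.IsProbabilityModel) {c W ρ : ℝ} (hc : 0 ≤ c) (hW0 : 0 ≤ W)
    (hρ0 : 0 ≤ ρ) (hρ1 : ρ < 1) (hρ : ∀ t < S.T, spectralNorm (S.A - S.B * S.K t) ≤ ρ)
    (hP : ∀ s v, l2norm (S.riccati s *ᵥ v) ≤ c * l2norm v)
    (hW : ∀ k, 1 ≤ k → l2norm (S.w k) ≤ W) (s k : ℕ) :
    l2norm (S.linCoeff s k) ≤ c * W / (1 - ρ) := by
  have hgap : 0 < 1 - ρ := sub_pos.2 hρ1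
  have hcW : 0 ≤ c * W := mul_nonneg hc hW0
  set M := c * W / (1 - ρ) with hM
  have hM0 : 0 ≤ M := div_nonneg hcW hgap.le
  have hMeq : M * (1 - ρ) = c * W := div_mul_cancel₀ _ hgap.ne'
  induction s generalizing k with
  | zero => rw [linCoeff, l2norm_zero]; exact hM0
  | succ s ih =>
    obtain ⟨h0, h1⟩ := hp.1 (S.T - ((s : ℤ) + 1)) (by omega) k
    have e0 := S.l2norm_forcing_le hp hc hP hW s k
    have e1 := mul_le_mul_of_nonneg_left (ih k) (sub_nonneg.2 h1)
    have e2 := mul_le_mul_of_nonneg_left (ih (k - 1)) h0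
    have e3 := mul_le_mul_of_nonneg_right h1 hcW
    have e4 : l2norm (S.forcing s k) ≤ M + c * W := by linarith
    refine (S.l2norm_linCoeff_succ_le hρ0 hρ s k).trans
      ((mul_le_mul_of_nonneg_left e4 hρ0).trans ?_)
    nlinarith

/-- The inverses `(Bᵀ P B + R)⁻¹` are bounded in terms of a lower bound for the quadratic form `R`. -/
lemma l2norm_inv_mulVec_le {P : Matrix (Fin n) (Fin n) ℝ} (hP : P.PosSemidef)
    (hR : S.R.PosDef) {a : ℝ} (ha : 0 < a) (haR : ∀ u, a * l2norm u ^ 2 ≤ u ⬝ᵥ (S.R *ᵥ u))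
    (v : Fin m → ℝ) : l2norm ((S.Bᵀ * P * S.B + S.R)⁻¹ *ᵥ v) ≤ a⁻¹ * l2norm v := by
  have hdet := (Matrix.isUnit_iff_isUnit_det _).1 (S.posDef_quadratic hP hR).isUnit
  set z := (S.Bᵀ * P * S.B + S.R)⁻¹ *ᵥ v with hz
  have hv : (S.Bᵀ * P * S.B + S.R) *ᵥ z = v := by
    rw [hz, Matrix.mulVec_mulVec, Matrix.mul_nonsing_inv _ hdet, Matrix.one_mulVec]
  have h1 := haR z
  have h2 := hP.dotProduct_mulVec_nonneg (S.B *ᵥ z)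
  have h3 : z ⬝ᵥ v = (S.B *ᵥ z) ⬝ᵥ (P *ᵥ (S.B *ᵥ z)) + z ⬝ᵥ (S.R *ᵥ z) := by
    rw [← hv, Matrix.add_mulVec, dotProduct_add, ← Matrix.mulVec_mulVec, ← Matrix.mulVec_mulVec,
      dotProduct_mulVec_transpose]
  rw [star_trivial] at h2
  have h4 := dotProduct_le_l2norm_mul z v
  rw [le_inv_mul_iff₀ ha]
  rcases (l2norm_nonneg z).eq_or_lt with h0 | h0
  · rw [← h0, mul_zero]; exact l2norm_nonneg v
  · nlinarith

lemma optAction_add_mulVec (s k : ℕ) (x : Fin n → ℝ) :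
    S.optAction s k x - -(S.K (S.T - ((s : ℤ) + 1)) *ᵥ x) =
      -((S.Bᵀ * S.riccati s * S.B + S.R)⁻¹ *ᵥ (S.Bᵀ *ᵥ S.forcing s k)) := by
  rw [optAction, K, P_eq]
  simp only [Matrix.mulVec_add, ← Matrix.mulVec_mulVec]
  abel

end Problem

/-! ### Convergence along the filled-in sequence -/

/-- If the rows of a bounded double sequence satisfy `f i ≤ ρ (f (i + 1) + q i)` eventually, where
`ρ < 1` and each `q i` tends to zero, then each row tends to zero: after `N` steps the rows are at
most `ρ ^ N M` up to an error that vanishes. -/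
lemma tendsto_zero_of_le_mul_succ {f q : ℕ → ℕ → ℝ} {ρ M : ℝ} (hρ0 : 0 ≤ ρ) (hρ1 : ρ < 1)
    (hf0 : ∀ i j, 0 ≤ f i j) (hfM : ∀ i j, f i j ≤ M)
    (hq : ∀ i, Tendsto (q i) atTop (𝓝 0))
    (hstep : ∀ i, ∀ᶠ j in atTop, f i j ≤ ρ * (f (i + 1) j + q i j)) (i : ℕ) :
    Tendsto (f i) atTop (𝓝 0) := by
  have key : ∀ (N i : ℕ) (ε : ℝ), 0 < ε → ∀ᶠ j in atTop, f i j ≤ ρ ^ N * M + ε := by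
    intro N
    induction N with
    | zero =>
      intro i ε hε
      filter_upwards with j
      have := hfM i j
      rw [pow_zero, one_mul]
      linarith
    | succ N ih =>
      intro i ε hε
      filter_upwards [hstep i, ih (i + 1) (ε / 2) (half_pos hε),
        (hq i).eventually_le_const (half_pos hε)] with j h1 h2 h3
      have h4 : f (i + 1) j + q i j ≤ ρ ^ N * M + ε := by linarith
      have h5 := mul_le_mul_of_nonneg_left h4 hρ0
      rw [pow_succ']
      nlinarith
  have hpow : Tendsto (fun N : ℕ => ρ ^ N * M) atTop (𝓝 0) := by
    simpa using (tendsto_pow_atTop_nhds_zero_of_lt_one hρ0 hρ1).mul_const M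
  refine tendsto_order.2 ⟨fun a ha => .of_forall fun j => ha.trans_le (hf0 i j), fun a ha => ?_⟩
  obtain ⟨N, hN⟩ := (hpow.eventually_lt_const (half_pos ha)).exists
  filter_upwards [key N i (a / 4) (by linarith)] with j hj
  linarith

/-- Along the filled-in sequence, `k'` is nondecreasing and still grows sublinearly. -/
lemma IsFilledIn.monotone_and_tendsto {t : ℕ → ℤ} {k : ℕ → ℕ} {t' : ℕ → ℤ} {k' : ℕ → ℕ}
    (hfill : IsFilledIn t k t' k') (ht : StrictAnti t) (hk : Monotone k)
    (hkt : Tendsto (fun i => (k i : ℝ) / (t i : ℝ)) atTop (𝓝 0)) :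
    Monotone k' ∧ Tendsto (fun j => (k' j : ℝ) / (t' j : ℝ)) atTop (𝓝 0) := by
  obtain ⟨ht', hk'⟩ := hfill
  have hlin : ∀ i : ℕ, t i ≤ t 0 - i := fun i => by
    induction i with
    | zero => simp
    | succ i ih =>
      have := ht (Nat.lt_add_one i)
      push_cast
      omega
  -- the block that contains the position `j`
  have hblock : ∀ j, ∃ i, t (i + 1) < t' j ∧ t' j ≤ t i := fun j => by
    have hex : ∃ i, t (i + 1) < t' j := ⟨j, by
      have := hlin (j + 1)
      rw [ht']
      push_cast at this
      omega⟩
    classical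
    refine ⟨Nat.find hex, Nat.find_spec hex, ?_⟩
    rcases h : Nat.find hex with _ | i
    · rw [ht']; omega
    · exact not_lt.1 (Nat.find_min hex (m := i) (by omega))
  choose b hb1 hb2 using hblock
  have hkb : ∀ j, k' j = k (b j) := fun j => hk' _ _ (hb1 j) (hb2 j)
  have hbmono : Monotone b := fun i j hij => by
    by_contra! hlt
    have h1 : t (b i) ≤ t (b j + 1) := ht.antitone hlt
    have h2 := hb1 j
    have h3 := hb2 i
    rw [ht'] at h2 h3
    omega
  have hbtop : Tendsto b atTop atTop := by
    refine tendsto_atTop.2 fun N => ?_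
    filter_upwards [eventually_ge_atTop (t 0 - t N).toNat] with j hj
    by_contra! hlt
    have h1 : t N ≤ t (b j + 1) := ht.antitone hlt
    have h2 := hb1 j
    rw [ht'] at h2
    omega
  refine ⟨fun i j hij => by rw [hkb, hkb]; exact hk (hbmono hij), ?_⟩
  have hneg : ∀ᶠ j in atTop, t (b j) < 0 := by
    filter_upwards [hbtop.eventually_ge_atTop ((t 0).toNat + 1)] with j hj
    have := hlin (b j)
    omega
  refine squeeze_zero_norm' ?_ (by simpa using (hkt.comp hbtop).norm)
  filter_upwards [hneg] with j hj
  have h1 : (t' j : ℝ) ≤ t (b j) := by exact_mod_cast hb2 j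
  have h2 : (t (b j) : ℝ) < 0 := by exact_mod_cast hj
  have h3 : ‖(t (b j) : ℝ)‖ ≤ ‖(t' j : ℝ)‖ := by
    rw [Real.norm_of_nonpos h2.le, Real.norm_of_nonpos (h1.trans h2.le)]
    linarith
  calc ‖(k' j : ℝ) / (t' j : ℝ)‖ = ‖(k (b j) : ℝ)‖ / ‖(t' j : ℝ)‖ := by rw [hkb, norm_div]
    _ ≤ ‖(k (b j) : ℝ)‖ / ‖(t (b j) : ℝ)‖ :=
      div_le_div_of_nonneg_left (norm_nonneg _) (norm_pos_iff.2 h2.ne) h3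
    _ = _ := by simp

/-- Along the filled-in sequence the disturbance probability vanishes, also when the time is
shifted by a fixed amount while the number of disturbances is kept. -/
lemma IsFilledIn.tendsto_p {n m : ℕ} {S : Problem n m} {t : ℕ → ℤ} {k : ℕ → ℕ} {t' : ℕ → ℤ}
    {k' : ℕ → ℕ} (hfill : IsFilledIn t k t' k') (hdecay : S.ProbabilityDecays)
    (ht : StrictAnti t) (htT : ∀ i, t i ≤ S.T) (hk : Monotone k)
    (hkt : Tendsto (fun i => (k i : ℝ) / (t i : ℝ)) atTop (𝓝 0)) (i : ℕ) :
    Tendsto (fun j => S.p (t' j + i) (k' j)) atTop (𝓝 0) := by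
  obtain ⟨hmono, hlim⟩ := hfill.monotone_and_tendsto ht hk hkt
  rw [← tendsto_add_atTop_iff_nat i]
  have ht' : ∀ j, t' (j + i) + i = t 0 - j := fun j => by
    rw [hfill.1]; push_cast; ring
  simp only [ht']
  refine hdecay _ (fun j => k' (j + i)) (fun a b hab => hmono (by omega))
    (strictAnti_nat_of_succ_lt fun j => by push_cast; omega)
    (fun j => by have := htT 0; omega) ?_
  have hlim' := ((tendsto_add_atTop_iff_nat i).2 hlim).norm.const_mul 2
  rw [norm_zero, mul_zero] at hlim'
  refine squeeze_zero_norm' ?_ hlim'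
  -- once `i < |t 0 - j|`, shifting by `i` at most doubles the denominator
  filter_upwards [eventually_ge_atTop ((t 0).toNat + i + 1)] with j hj
  have h1 : t' (j + i) = t 0 - j - i := by have := ht' j; omega
  have h2 : ((t 0 - j : ℤ) : ℝ) ≤ -(i : ℝ) - 1 := by
    have : t 0 - j ≤ -(i : ℤ) - 1 := by omega
    exact_mod_cast this
  have hi : (0 : ℝ) ≤ i := Nat.cast_nonneg i
  have h3 : ((t' (j + i) : ℤ) : ℝ) = ((t 0 - j : ℤ) : ℝ) - i := by rw [h1]; push_cast; ring
  rw [norm_div, norm_div, h3, Real.norm_of_nonpos (show ((t 0 - j : ℤ) : ℝ) ≤ 0 by linarith),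
    Real.norm_of_nonpos (show ((t 0 - j : ℤ) : ℝ) - i ≤ 0 by linarith), ← mul_div_assoc,
    div_le_div_iff₀ (by linarith) (by linarith)]
  nlinarith [norm_nonneg ((k' (j + i) : ℕ) : ℝ)]

end SparseLQR

theorem mainTheorem2 {n m : ℕ} (S : SparseLQR.Problem n m)
    (hQ : S.Q.PosSemidef) (hQT : S.QT.PosSemidef) (hR : S.R.PosDef)
    (hw : ∃ wHat : ℝ, ∀ k, 1 ≤ k → SparseLQR.l2norm (S.w k) ≤ wHat)
    (hp : S.IsProbabilityModel)
    (hctrl : SparseLQR.Controllable S.A S.B)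
    (hobs : ∃ (l : ℕ) (L : Matrix (Fin l) (Fin n) ℝ),
      S.Q = L.transpose * L ∧ SparseLQR.Observable S.A L)
    (hstab : ∃ γ : ℝ, 0 < γ ∧ ∀ t < S.T, SparseLQR.spectralNorm (S.A - S.B * S.K t) < 1 - γ)
    (hdecay : S.ProbabilityDecays)
    (t : ℕ → ℤ) (k : ℕ → ℕ) (ht : StrictAnti t) (htT : ∀ i, t i ≤ S.T)
    (hk : ∀ i, k (i + 1) = k i ∨ k (i + 1) = k i + 1)
    (hkt : Filter.Tendsto (fun i => (k i : ℝ) / (t i : ℝ)) Filter.atTop (nhds 0))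
    (t' : ℕ → ℤ) (k' : ℕ → ℕ) (hfill : SparseLQR.IsFilledIn t k t' k') :
    Filter.Tendsto (fun j => SparseLQR.l2norm (S.r (t' j) (k' j))) Filter.atTop (nhds 0) ∧
    (∃ π, S.IsDisturbanceAware π) ∧
    ∀ π, S.IsDisturbanceAware π → ∀ x : ℕ → Fin n → ℝ,
      Filter.Tendsto
        (fun j => SparseLQR.l2norm
          (π (t' j) (k' j) (x j) - -(S.K (t' j)).mulVec (x j)))
        Filter.atTop (nhds 0) := by
  obtain ⟨wHat, hwHat⟩ := hw
  obtain ⟨γ, hγ, hK⟩ := hstab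
  set W : ℝ := max wHat 0
  have hW0 : 0 ≤ W := le_max_right _ _
  have hW : ∀ k, 1 ≤ k → SparseLQR.l2norm (S.w k) ≤ W := fun k hk =>
    (hwHat k hk).trans (le_max_left _ _)
  set ρ : ℝ := 1 - γ with hρdef
  have hρ : ∀ t < S.T, SparseLQR.spectralNorm (S.A - S.B * S.K t) ≤ ρ := fun t ht => (hK t ht).le
  have hρ0 : 0 ≤ ρ := (norm_nonneg _).trans (hρ (S.T - 1) (by omega))
  have hρ1 : ρ < 1 := by linarith
  obtain ⟨c, hc, hP⟩ := S.exists_riccati_bound hQ hQT hR hρ0 hρ1 hρ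
  set M : ℝ := c * W / (1 - ρ)
  have hM : ∀ s k, SparseLQR.l2norm (S.linCoeff s k) ≤ M :=
    S.l2norm_linCoeff_le hp hc.le hW0 hρ0 hρ1 hρ hP hW
  have hforcing : ∀ s k, SparseLQR.l2norm (S.forcing s k) ≤
      SparseLQR.l2norm (S.linCoeff s k) + S.p (S.T - ((s : ℤ) + 1)) k * (M + c * W) := by
    intro s k
    obtain ⟨h0, h1⟩ := hp.1 (S.T - ((s : ℤ) + 1)) (by omega) k
    have e1 := S.l2norm_forcing_le hp hc.le hP hW s k
    have e2 := mul_le_mul_of_nonneg_left (hM s (k - 1)) h0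
    have e3 := mul_nonneg h0 (SparseLQR.l2norm_nonneg (S.linCoeff s k))
    linarith
  have hkmono : Monotone k := monotone_nat_of_le_succ fun i => by
    rcases hk i with h | h <;> omega
  have hpt := fun i => hfill.tendsto_p hdecay ht htT hkmono hkt i
  have hq : ∀ i : ℕ, Filter.Tendsto (fun j => S.p (t' j + i) (k' j) * (M + c * W))
      Filter.atTop (nhds 0) := fun i => by simpa using (hpt i).mul_const (M + c * W)
  have htime : ∀ i : ℕ, ∀ᶠ j in Filter.atTop, ∃ s : ℕ, t' j + i = S.T - ((s : ℤ) + 1) := by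
    intro i
    filter_upwards [Filter.eventually_ge_atTop (i + 1)] with j hj
    refine ⟨(S.T - 1 - (t' j + i)).toNat, ?_⟩
    have h1 := hfill.1 j
    have h2 := htT 0
    omega
  have hr0 : ∀ s : ℕ, S.r (S.T - ((s : ℤ) + 1)) = S.linCoeff (s + 1) := fun s => by
    have : (S.T - (S.T - ((s : ℤ) + 1))).toNat = s + 1 := by omega
    funext k
    rw [SparseLQR.Problem.r, this]
  have hr1 : ∀ s : ℕ, S.r (S.T - ((s : ℤ) + 1) + 1) = S.linCoeff s := fun s => by
    have : (S.T - (S.T - ((s : ℤ) + 1) + 1)).toNat = s := by omega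
    funext k
    rw [SparseLQR.Problem.r, this]
  have hr : ∀ i : ℕ, Filter.Tendsto (fun j => SparseLQR.l2norm (S.r (t' j + i) (k' j)))
      Filter.atTop (nhds 0) := by
    refine SparseLQR.tendsto_zero_of_le_mul_succ
      (q := fun i j => S.p (t' j + i) (k' j) * (M + c * W)) hρ0 hρ1
      (fun i j => SparseLQR.l2norm_nonneg _) (fun i j => hM _ _) hq fun i => ?_
    filter_upwards [htime i] with j ⟨s, hs⟩
    rw [Nat.cast_succ, ← add_assoc, hs, hr0, hr1]
    exact (S.l2norm_linCoeff_succ_le hρ0 hρ s (k' j)).trans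
      (mul_le_mul_of_nonneg_left (hforcing s (k' j)) hρ0)
  refine ⟨by simpa using hr 0, ⟨_, S.isDisturbanceAware_optPolicy hQ hQT hR hp⟩,
    fun π hπ x => ?_⟩
  obtain ⟨a, ha, haR⟩ := SparseLQR.exists_pos_mul_l2norm_sq_le hR
  obtain ⟨β, hβ, hB⟩ := SparseLQR.exists_l2norm_mulVec_le S.Bᵀ
  have hlim := ((hr 1).add (hq 0)).const_mul (a⁻¹ * β)
  rw [add_zero, mul_zero] at hlim
  refine squeeze_zero' (.of_forall fun j => SparseLQR.l2norm_nonneg _) ?_ hlim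
  filter_upwards [htime 0] with j ⟨s, hs⟩
  rw [Nat.cast_zero, add_zero] at hs
  simp only [Nat.cast_zero, Nat.cast_one, add_zero]
  rw [hs, hr1, hπ.eq_optAction hQ hQT hR hp, S.optAction_add_mulVec, SparseLQR.l2norm_neg,
    mul_assoc]
  refine (S.l2norm_inv_mulVec_le (S.riccati_posSemidef hQ hQT hR s) hR ha haR _).trans
    (mul_le_mul_of_nonneg_left ?_ (inv_nonneg.2 ha.le))
  exact (hB _).trans (mul_le_mul_of_nonneg_left (hforcing s (k' j)) hβ)
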